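/- Let $(R,\mathfrak m)$ be a complete Noetherian local domain containing a field of prime characteristic $p$, and let $R_\infty=\bigcup_{n\ge 0}R^{1/p^n}$ be its perfect closure, the ring obtained by adjoining to $R$ the $p^n$-th roots of all its elements. Let $v\colon R_\infty\to\mathbb Q\cup\{\infty\}$ be a valuation, i.e. $v(a)=\infty$ if and only if $a=0$, $v(ab)=v(a)+v(b)$ and $v(a+b)\ge\min\{v(a),v(b)\}$ for all $a,b$; assume that $v(a)\ge 0$ for all $a\in R_\infty$ and $v(r)>0$ for all $r\in\mathfrak m$. A system of parameters for $R_\infty$ means a system of parameters $x_1,\dots,x_d$ of some Noetherian (automatically local) subring $B$ of $R_\infty$ containing $R$, that is, $d=\dim B$ and the radical of $(x_1,\dots,x_d)B$ is the maximal ideal of $B$. Then $R_\infty$ is almost Cohen–Macaulay with respect to $v$: for every system of parameters $x_1,\dots,x_d$ for $R_\infty$ and every $i=1,\dots,d$, the $R_\infty$-module $$\big((x_1,\dots,x_{i-1})R_\infty:_{R_\infty}x_i\big)\big/(x_1,\dots,x_{i-1})R_\infty$$ is almost zero, i.e. for every element $m$ of it and every real $\varepsilon>0$ there is $u\in R_\infty$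 with $v(u)<\varepsilon$ and $um=0$. More precisely, for every $a\in(x_1,\dots,x_{i-1})R_\infty:_{R_\infty}x_i$ there is a nonzero $c\in R$ such that $c^{1/p^n}a\in(x_1,\dots,x_{i-1})R_\infty$ for all $n\ge 0$. -/

import Mathlib

namespace AlmostCM

/-- An `A`-module `M` is almost zero with respect to the valuation `v` if every element of `M`
is killed by elements of `A` of order less than any prescribed real number `ε > 0`. -/
def AlmostZero {A : Type*} [CommRing A] (v : AddValuation A (WithTop ℚ))
    (M : Type*) [AddCommGroup M] [Module A M] : Prop :=
  ∀ m : M, ∀ ε : ℝ, 0 < ε → ∃ a : A, (∃ q : ℚ, v a = (q : WithTop ℚ) ∧ (q : ℝ) < ε) ∧ a • m = 0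

/-- The ideal generated by the members of the sequence `x` that come strictly before `x i`. -/
def initialIdeal {A : Type*} [CommRing A] {d : ℕ} (x : Fin d → A) (i : Fin d) : Ideal A :=
  Ideal.span (x '' {j | j < i})

/-- The colon ideal of the preceding members of the sequence `x` by `x i`. -/
def colonIdeal {A : Type*} [CommRing A] {d : ℕ} (x : Fin d → A) (i : Fin d) : Ideal A :=
  (initialIdeal x i).colon {x i}

/-- `x` is an almost regular sequence if, for each `i`, the colon ideal of the preceding members
by `x i`, modulo the ideal generated by these members, is almost zero. -/
def IsAlmostRegular {A : Type*} [CommRing A] (v : AddValuation A (WithTop ℚ)) {d : ℕ}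
    (x : Fin d → A) : Prop :=
  ∀ i : Fin d,
    AlmostZero v (↥(colonIdeal x i) ⧸ (initialIdeal x i).submoduleOf (colonIdeal x i))

/-- A system of parameters of a local ring `B` (used for Noetherian `B`): a sequence of `dim B`
elements generating an ideal whose radical is the maximal ideal. -/
def IsSystemOfParameters {B : Type*} [CommRing B] [IsLocalRing B] {d : ℕ} (x : Fin d → B) : Prop :=
  ringKrullDim B = (d : WithBot ℕ∞) ∧
    (Ideal.span (Set.range x)).radical = IsLocalRing.maximalIdeal B

/-- A system of parameters of a (not necessarily Noetherian) ring `A` over a subring `R₀`: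
a system of parameters of some Noetherian local subring of `A` that contains `R₀`. -/
def IsSystemOfParametersOver {A : Type*} [CommRing A] (R₀ : Subring A) {d : ℕ}
    (x : Fin d → A) : Prop :=
  ∃ B : Subring A, R₀ ≤ B ∧ IsNoetherianRing B ∧ ∃ _ : IsLocalRing B,
    ∃ y : Fin d → B, IsSystemOfParameters y ∧ ∀ i, x i = (y i : A)

/-- `A` is almost Cohen-Macaulay with respect to `v` if every system of parameters
is an almost regular sequence. -/
def IsAlmostCohenMacaulay {A : Type*} [CommRing A] (R₀ : Subring A)
    (v : AddValuation A (WithTop ℚ)) : Prop :=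
  ∀ (d : ℕ) (x : Fin d → A), IsSystemOfParametersOver R₀ x → IsAlmostRegular v x

end AlmostCM

/-! Let `w` be `d ≤ dim R` elements generating an ideal primary to the maximal ideal. A coefficient
field `k` of `R` exists because extensions of the perfect prime field are formally smooth. Sending
the variables to `w` makes `R` finite over `A = k[[X_1, …, X_d]]`, and the map is injective by
dimension. A free `A`-submodule of full rank contains `c R` for some nonzero `c` in `A`. Powers of
the variables form a regular sequence in `A`, so this single `c` kills the colon relations on `w_1 ^
t, …, w_d ^ t` for every `t` (`IsLocalRing.exists_mul_mem_span_pow`).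

Given parameters `x` of the perfect closure, some `w_j = x_j ^ p ^ e` lie in `R` and form such a
sequence. Raising a colon relation for `a` to the power `p ^ m`, with `m` large, gives one in `R` on
the `w_j ^ p ^ (m - e)`. It is killed by `c`, and taking `p ^ m`-th roots puts `c ^ (1 / p ^ m) * a`
in the ideal of the preceding `x_j`. As `c` does not depend on `m`, the values `v c / p ^ m` tend to
zero. -/

/-! ### Formal smoothness over perfect fields and coefficient fields -/

section FieldFormallySmooth

open Algebra MvPolynomial

/-- For a field extension `k / F`, vanishing of the first cotangent homology means that a polynomial
relation all of whose partial derivatives vanish lies in the square of the relation ideal. -/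
lemma Algebra.subsingleton_h1Cotangent_iff_mem_ker_sq {F k : Type*} [Field F] [Field k]
    [Algebra F k] :
    Subsingleton (H1Cotangent F k) ↔ ∀ f : MvPolynomial k F,
      aeval (_root_.id : k → k) f = 0 → (∀ i, aeval (_root_.id : k → k) (pderiv i f) = 0) →
        f ∈ RingHom.ker (aeval (R := F) (_root_.id : k → k)) ^ 2 := by
  have key : ∀ x : (Generators.self F k).toExtension.ker,
      (Generators.self F k).toExtension.cotangentComplex (.mk x) = 0 ↔
        ∀ i, aeval (_root_.id : k → k) (pderiv i x.1) = 0 := by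
    intro x
    rw [← (Generators.self F k).cotangentSpaceBasis.repr.map_eq_zero_iff,
      Extension.cotangentComplex_mk, Finsupp.ext_iff]
    refine forall_congr' fun i => ?_
    rw [Generators.cotangentSpaceBasis_repr_one_tmul]
    rfl
  have hker : (Generators.self F k).toExtension.ker =
      RingHom.ker (aeval (R := F) (_root_.id : k → k)) := (Generators.self F k).ker_eq_ker_aeval_val
  have hsq : (Generators.self F k).toExtension.ker ^ 2 =
      RingHom.ker (aeval (R := F) (_root_.id : k → k)) ^ 2 := congrArg (· ^ 2) hker
  rw [Extension.subsingleton_h1Cotangent, injective_iff_map_eq_zero]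
  constructor
  · intro h f hf hd
    have hf' : f ∈ (Generators.self F k).toExtension.ker := by rw [hker]; exact hf
    have := h (.mk ⟨f, hf'⟩) ((key _).2 hd)
    rw [Extension.Cotangent.mk_eq_zero_iff] at this
    exact hsq.le this
  · intro h x hx
    obtain ⟨x, rfl⟩ := Extension.Cotangent.mk_surjective x
    rw [Extension.Cotangent.mk_eq_zero_iff]
    refine hsq.ge (h x.1 (hker.le x.2) ((key x).1 hx))

/-- Any extension of a perfect field is formally smooth. -/
lemma Algebra.FormallySmooth.of_perfectField_of_field (F k : Type*) [Field F] [PerfectField F]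
    [Field k] [Algebra F k] : Algebra.FormallySmooth F k := by
  classical
  refine ⟨inferInstance, Algebra.subsingleton_h1Cotangent_iff_mem_ker_sq.2 fun f hf hd => ?_⟩
  -- Only finitely many variables occur in `f`, so the relation descends to a finitely generated
  -- subextension `L`, which is formally smooth because `F` is perfect.
  obtain ⟨L, _, hfL⟩ : ∃ L : IntermediateField F k, Algebra.EssFiniteType F L ∧
      (f.vars : Set k) ⊆ L :=
    ⟨IntermediateField.adjoin F (f.vars : Set k),
      IntermediateField.essFiniteType_iff.2 ⟨f.vars, rfl⟩, IntermediateField.subset_adjoin F _⟩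
  have hL : Subsingleton (H1Cotangent F L) := FormallySmooth.subsingleton_h1Cotangent
  rw [Algebra.subsingleton_h1Cotangent_iff_mem_ker_sq] at hL
  obtain ⟨g, rfl⟩ := MvPolynomial.exists_rename_eq_of_vars_subset_range f
    (Subtype.val : L → k) Subtype.val_injective (by
      rw [Subtype.range_coe]
      exact hfL)
  have hev : ∀ q : MvPolynomial L F,
      aeval (_root_.id : k → k) (rename Subtype.val q) = ((aeval (_root_.id : L → L) q : L) : k) := by
    intro q
    rw [aeval_rename, Function.id_comp]
    exact (aeval_algebraMap_apply (B := k) (_root_.id : L → L) q)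
  have hg := hL g (by rw [hev] at hf; exact_mod_cast hf) fun i => by
    have := hd i
    rw [pderiv_rename Subtype.val_injective, hev] at this
    exact_mod_cast this
  have hmap : (RingHom.ker (aeval (R := F) (_root_.id : L → L))).map
      (rename (R := F) (Subtype.val : L → k)) ≤
      RingHom.ker (aeval (R := F) (_root_.id : k → k)) := by
    rw [Ideal.map_le_iff_le_comap]
    intro q hq
    rw [Ideal.mem_comap, RingHom.mem_ker, hev, RingHom.mem_ker.1 hq]
    rfl
  refine Ideal.pow_right_mono hmap 2 ?_
  rw [← Ideal.map_pow]
  exact Ideal.mem_map_of_mem _ hg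

end FieldFormallySmooth

/-- A complete local ring of characteristic `p` has a coefficient field. -/
lemma IsLocalRing.exists_residue_comp_eq_id {R : Type*} [CommRing R] [IsLocalRing R]
    [IsAdicComplete (IsLocalRing.maximalIdeal R) R] (p : ℕ) [Fact p.Prime] [CharP R p] :
    ∃ σ : ResidueField R →+* R, (residue R).comp σ = RingHom.id _ := by
  let _ : Algebra (ZMod p) R := ZMod.algebra R p
  have := Algebra.FormallySmooth.of_perfectField_of_field (ZMod p) (ResidueField R)
  obtain ⟨g, hg⟩ := Algebra.FormallySmooth.exists_mkₐ_comp_eq_of_isAdicComplete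
    (I := maximalIdeal R) (AlgHom.id (ZMod p) (ResidueField R) : _ →ₐ[ZMod p] R ⧸ maximalIdeal R)
  exact ⟨g.toRingHom, RingHom.ext fun x => DFunLike.congr_fun hg x⟩

/-! ### Power series: ideals of powers of variables, and evaluation -/

namespace MvPowerSeries

variable {σ k : Type*} [CommRing k]

/-- Membership in an ideal generated by `t`-th powers of variables, read off from coefficients. -/
lemma mem_span_X_pow_iff (s : Finset σ) (t : ℕ) (f : MvPowerSeries σ k) :
    f ∈ Ideal.span ((fun i => (X i : MvPowerSeries σ k) ^ t) '' (s : Set σ)) ↔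
      ∀ m : σ →₀ ℕ, (∀ i ∈ s, m i < t) → coeff m f = 0 := by
  classical
  induction s using Finset.induction_on generalizing f with
  | empty =>
    simp [MvPowerSeries.ext_iff]
  | insert a s ha ih =>
    rw [Finset.coe_insert, Set.image_insert_eq, Ideal.span_insert, Submodule.mem_sup]
    constructor
    · rintro ⟨g, hg, h, hh, rfl⟩ m hm
      rw [map_add, X_pow_dvd_iff.1 (Ideal.mem_span_singleton.1 hg) m (hm a (by simp)),
        (ih h).1 hh m fun i hi => hm i (by simp [hi]), add_zero]
    · intro hf
      -- The part of `f` made of the monomials divisible by `X a ^ t`.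
      let g : MvPowerSeries σ k := fun m => if m a < t then 0 else coeff m f
      have hg : ∀ m, coeff m g = if m a < t then 0 else coeff m f := fun m => rfl
      refine ⟨g, Ideal.mem_span_singleton.2 (X_pow_dvd_iff.2 fun m hm => by rw [hg, if_pos hm]),
        f - g, (ih _).2 fun m hm => ?_, by ring⟩
      rw [map_sub, hg]
      split_ifs with h
      · rw [hf m (by simpa [h] using hm), sub_zero]
      · exact sub_self _

/-- Powers of distinct variables form a regular sequence. -/
lemma mem_span_X_pow_of_X_pow_mul_mem {s : Finset σ} {t : ℕ} {a : σ} (ha : a ∉ s)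
    {f : MvPowerSeries σ k}
    (hf : (X a : MvPowerSeries σ k) ^ t * f ∈
      Ideal.span ((fun i => (X i : MvPowerSeries σ k) ^ t) '' (s : Set σ))) :
    f ∈ Ideal.span ((fun i => (X i : MvPowerSeries σ k) ^ t) '' (s : Set σ)) := by
  classical
  rw [mem_span_X_pow_iff] at hf ⊢
  intro m hm
  have := hf (Finsupp.single a t + m) fun i hi => by
    rw [Finsupp.add_apply, Finsupp.single_eq_of_ne (by rintro rfl; exact ha hi), zero_add]
    exact hm i hi
  rwa [X_pow_eq, coeff_add_monomial_mul, one_mul] at this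

/-- Evaluation of power series at elements of an ideal defining a complete topology. -/
lemma exists_ringHom_apply_X {S : Type*} [CommRing S] [Finite σ] (I : Ideal S) [IsAdicComplete I S]
    (φ : k →+* S) (y : σ → S) (hy : ∀ i, y i ∈ I) :
    ∃ Φ : MvPowerSeries σ k →+* S, (∀ a, Φ (C a) = φ a) ∧ ∀ i, Φ (X i) = y i := by
  let e : MvPolynomial σ k →+* S := MvPolynomial.eval₂Hom φ y
  have he : (MvPolynomial.idealOfVars σ k).map e ≤ I := by
    rw [MvPolynomial.idealOfVars, Ideal.map_span, Ideal.span_le]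
    rintro _ ⟨_, ⟨i, rfl⟩, rfl⟩
    simpa [e] using hy i
  have hle : ∀ n, MvPolynomial.idealOfVars σ k ^ n ≤ (I ^ n).comap e := fun n => by
    rw [← Ideal.map_le_iff_le_comap, Ideal.map_pow]
    exact Ideal.pow_right_mono he n
  -- Modulo `I ^ n` a truncation suffices, since `e` sends the variables into `I`; completeness
  -- glues these maps.
  let F : ∀ n, MvPowerSeries σ k →+* S ⧸ I ^ n := fun n =>
    (Ideal.quotientMap (I ^ n) e (hle n)).comp (truncTotalAlgHom σ k n).toRingHom
  have hF : ∀ n (q : MvPowerSeries σ k), F n q = Ideal.Quotient.mk (I ^ n) (e (truncTotal n q)) :=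
    fun n q => rfl
  have hcompat : ∀ {m n : ℕ} (hle : m ≤ n), (Ideal.Quotient.factorPow I hle).comp (F n) = F m := by
    intro m n hmn
    ext q
    rw [RingHom.comp_apply, hF, hF]
    change Ideal.Quotient.mk (I ^ m) _ = _
    rw [Ideal.Quotient.eq, ← map_sub]
    exact hle m (truncTotal_sub_truncTotal_mem_pow_idealOfVars hmn le_rfl q)
  have hpoly : ∀ q : MvPolynomial σ k, IsAdicComplete.liftRingHom I F hcompat q = e q := by
    intro q
    rw [← sub_eq_zero]
    refine (IsHausdorff.haus' (I := I) _ fun n => ?_)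
    rw [SModEq.zero, smul_eq_mul, Ideal.mul_top, ← Ideal.Quotient.eq,
      IsAdicComplete.mk_liftRingHom]
    exact congrArg (Ideal.quotientMap (I ^ n) e (hle n)) ((truncTotalAlgHom σ k n).commutes q)
  refine ⟨IsAdicComplete.liftRingHom I F hcompat, fun a => ?_, fun i => ?_⟩
  · rw [← MvPolynomial.coe_C, hpoly]; simp [e]
  · rw [← MvPolynomial.coe_X, hpoly]; simp [e]

end MvPowerSeries

/-! ### Finite modules: complete Nakayama and uniform denominators -/

lemma IsPrecomplete.pi {A ι : Type*} [CommRing A] [Finite ι] (I : Ideal A) [IsPrecomplete I A] :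
    IsPrecomplete I (ι → A) := by
  classical
  have := Fintype.ofFinite ι
  have hmem : ∀ (n : ℕ) (x : ι → A), x ∈ (I ^ n • ⊤ : Submodule A (ι → A)) ↔
      ∀ i, x i ∈ (I ^ n • ⊤ : Submodule A A) := by
    intro n x
    constructor
    · intro hx i
      have := Submodule.mem_map_of_mem (f := LinearMap.proj (R := A) (φ := fun _ : ι => A) i) hx
      rw [Submodule.map_smul''] at this
      exact Submodule.smul_mono le_rfl le_top this
    · intro hx
      rw [← Finset.univ_sum_single x]
      refine Submodule.sum_mem _ fun i _ => ?_
      have := Submodule.mem_map_of_mem (f := LinearMap.single A (fun _ : ι => A) i) (hx i)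
      rw [Submodule.map_smul''] at this
      exact Submodule.smul_mono le_rfl le_top this
  refine ⟨fun f hf => ?_⟩
  have h : ∀ i, ∃ L : A, ∀ n, f n i ≡ L [SMOD (I ^ n • ⊤ : Submodule A A)] := fun i =>
    IsPrecomplete.prec' (I := I) (fun n => f n i) fun {m n} hmn => by
      have := hf hmn
      rw [SModEq.sub_mem] at this ⊢
      exact (hmem _ _).1 this i
  choose L hL using h
  refine ⟨L, fun n => ?_⟩
  rw [SModEq.sub_mem, hmem]
  intro i
  have := hL i n
  rwa [SModEq.sub_mem] at this

/-- The complete version of Nakayama's lemma. -/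
lemma Module.Finite.of_isPrecomplete_of_isHausdorff {A M : Type*} [CommRing A] [AddCommGroup M]
    [Module A M] (I : Ideal A) [IsPrecomplete I A] [IsHausdorff I M]
    (s : Finset M) (hs : Submodule.span A (s : Set M) ⊔ I • ⊤ = ⊤) : Module.Finite A M := by
  have := IsPrecomplete.pi (ι := s) I
  refine Module.Finite.of_surjective (Fintype.linearCombination A (Subtype.val : s → M))
    (surjective_of_mkQ_comp_surjective (I := I) ?_)
  rw [← LinearMap.range_eq_top, LinearMap.range_comp, Fintype.range_linearCombination,
    Subtype.range_coe_subtype]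
  rw [Submodule.map_mkQ_eq_top, sup_comm]
  exact hs

/-- If `B` is a finite algebra over a domain `A`, some nonzero element of `A` carries every
colon relation that is trivial over `A` into a trivial one over `B`. -/
lemma Module.Finite.exists_mul_mem_map_of_mul_mem_map (A B : Type*) [CommRing A] [IsDomain A]
    [CommRing B] [Algebra A B] [Module.Finite A B] :
    ∃ c : A, c ≠ 0 ∧ ∀ (I : Ideal A) (x : A), (∀ z, x * z ∈ I → z ∈ I) →
      ∀ b : B, algebraMap A B x * b ∈ I.map (algebraMap A B) →
        algebraMap A B c * b ∈ I.map (algebraMap A B) := by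
  classical
  -- A maximal independent set spans a free submodule modulo which `B` is torsion; multiplying
  -- denominators of finitely many generators gives a uniform `c`.
  obtain ⟨s, hs, hmax⟩ := exists_maximal_linearIndepOn A (_root_.id : B → B)
  have hmax' : ∀ r : B, ∃ a : A, a ≠ 0 ∧ a • r ∈ Submodule.span A (Set.range ((↑) : s → B)) := by
    intro r
    rw [Subtype.range_coe]
    by_cases hr : r ∈ s
    · exact ⟨1, one_ne_zero, by rw [one_smul]; exact Submodule.subset_span hr⟩
    · simpa using hmax r hr
  choose a ha0 ha using hmax'
  obtain ⟨g, hg⟩ := Module.Finite.fg_top (R := A) (M := B)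
  let c : A := ∏ r ∈ g, a r
  have hc : ∀ r : B, c • r ∈ Submodule.span A (Set.range ((↑) : s → B)) := by
    intro r
    have hr : r ∈ Submodule.span A (g : Set B) := by rw [hg]; trivial
    have hle : Submodule.span A (g : Set B) ≤
        (Submodule.span A (Set.range ((↑) : s → B))).comap (LinearMap.lsmul A B c) := by
      rw [Submodule.span_le]
      intro r hr
      change c • r ∈ Submodule.span A (Set.range ((↑) : s → B))
      rw [show c = (∏ r ∈ g.erase r, a r) * a r from (Finset.prod_erase_mul g a hr).symm, mul_smul]
      exact Submodule.smul_mem _ _ (ha r)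
    exact hle hr
  refine ⟨c, Finset.prod_ne_zero_iff.2 fun r _ => ha0 r, fun I x hx b hb => ?_⟩
  have hli : LinearIndependent A ((↑) : s → B) := hs
  -- Multiplication by `c` followed by coordinates. Being `A`-linear, it turns a colon relation in
  -- `B` into one in `A` for each coordinate.
  let ψ : B →ₗ[A] (s →₀ A) :=
    hli.repr ∘ₗ (LinearMap.lsmul A B c).codRestrict _ hc
  have hψ : ∀ r, Finsupp.linearCombination A ((↑) : s → B) (ψ r) = c • r := fun r =>
    hli.linearCombination_repr ⟨c • r, hc r⟩
  have hmem : ∀ z : B, z ∈ I.map (algebraMap A B) ↔ z ∈ (I • ⊤ : Submodule A B) := fun z => by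
    rw [Ideal.smul_top_eq_map]; rfl
  rw [← Algebra.smul_def, hmem] at hb ⊢
  have hcoord : ∀ i, ψ b i ∈ I := by
    intro i
    refine hx _ ?_
    have := Submodule.mem_map_of_mem (f := Finsupp.lapply i ∘ₗ ψ) hb
    rw [Submodule.map_smul''] at this
    have := Submodule.smul_mono le_rfl (le_top : _ ≤ (⊤ : Submodule A A)) this
    simpa using this
  rw [← hψ, Finsupp.linearCombination_apply, Finsupp.sum]
  exact Submodule.sum_mem _ fun i _ => Submodule.smul_mem_smul (hcoord i) trivial

/-! ### Dimension and injectivity of the parameter map -/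

/-- Incomparability: contraction of primes along an integral map is strictly monotone. -/
lemma RingHom.IsIntegral.ringKrullDim_le {A B : Type*} [CommRing A] [CommRing B] {f : A →+* B}
    (hf : f.IsIntegral) : ringKrullDim B ≤ ringKrullDim A := by
  let _ := f.toAlgebra
  have : Algebra.IsIntegral A B := ⟨hf⟩
  exact Order.krullDim_le_of_strictMono (PrimeSpectrum.comap f) fun P Q h =>
    Ideal.IsIntegral.comap_lt_comap (R := A) h

namespace MvPowerSeries

lemma maximalIdeal_eq_span_X {σ k : Type*} [Finite σ] [Field k] :
    IsLocalRing.maximalIdeal (MvPowerSeries σ k) = Ideal.span (Set.range X) := by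
  have := Fintype.ofFinite σ
  ext f
  have h := mem_span_X_pow_iff (k := k) (Finset.univ : Finset σ) 1 f
  simp only [pow_one, Finset.coe_univ, Set.image_univ, Finset.mem_univ, true_imp_iff,
    Nat.lt_one_iff] at h
  rw [h, IsLocalRing.mem_maximalIdeal, mem_nonunits_iff, isUnit_iff_constantCoeff,
    isUnit_iff_ne_zero, not_not, ← coeff_zero_eq_constantCoeff_apply]
  constructor
  · intro hf m hm
    rwa [show m = 0 from Finsupp.ext hm]
  · exact fun hf => hf 0 fun _ => rfl

lemma ringKrullDim_le {k : Type*} [Field k] (d : ℕ) :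
    ringKrullDim (MvPowerSeries (Fin d) k) ≤ d := by
  refine (ringKrullDim_le_spanFinrank_maximalIdeal _).trans ?_
  rw [maximalIdeal_eq_span_X]
  have h1 := Submodule.spanFinrank_span_le_ncard_of_finite (R := MvPowerSeries (Fin d) k)
    (Set.finite_range (X : Fin d → MvPowerSeries (Fin d) k))
  have h2 : (Set.range (X : Fin d → MvPowerSeries (Fin d) k)).ncard ≤ d := by
    rw [← Set.image_univ]
    simpa using Set.ncard_image_le (f := (X : Fin d → MvPowerSeries (Fin d) k)) Set.finite_univ
  exact_mod_cast h1.trans h2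

end MvPowerSeries

/-- A ring map from a power series ring in `d` variables to a domain of dimension at least `d`
is injective if it is integral. -/
lemma MvPowerSeries.injective_of_isIntegral {k R : Type*} [Field k] [CommRing R] [IsDomain R]
    {d : ℕ} (hd : d ≤ ringKrullDim R) (Φ : MvPowerSeries (Fin d) k →+* R) (hΦ : Φ.IsIntegral) :
    Function.Injective Φ := by
  rw [injective_iff_map_eq_zero]
  intro f hf
  by_contra hf0
  -- A nonzero `f` in the kernel would lower the dimension, while `R` stays integral over the
  -- quotient: `d + 1 ≤ dim R + 1 ≤ d`.
  have h1 := ringKrullDim_quotient_succ_le_of_nonZeroDivisor (mem_nonZeroDivisors_of_ne_zero hf0)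
  let Ψ : MvPowerSeries (Fin d) k ⧸ Ideal.span {f} →+* R :=
    Ideal.Quotient.lift _ Φ fun a ha => by
      obtain ⟨b, rfl⟩ := Ideal.mem_span_singleton.1 ha
      rw [map_mul, hf, zero_mul]
  have hΨ : Ψ.IsIntegral := by
    refine RingHom.IsIntegral.tower_top (Ideal.Quotient.mk _) Ψ ?_
    rwa [Ideal.Quotient.lift_comp_mk]
  have h2 := hΨ.ringKrullDim_le
  have h3 := (add_le_add_left (hd.trans h2) 1).trans (h1.trans (MvPowerSeries.ringKrullDim_le d))
  have : d + 1 ≤ d := by exact_mod_cast h3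
  omega

/-! ### Finiteness over power series and the uniform annihilator -/

open IsLocalRing in
/-- A local ring with a coefficient field `k` is finite over any complete `k`-algebra `A`, with ideal
of definition `I`, such that `I` generates an ideal primary to the maximal ideal. -/
lemma IsLocalRing.finite_of_radical_map_eq {k A R : Type*} [CommRing k] [CommRing A] [CommRing R]
    [Algebra k A] [Algebra k R] [Algebra A R] [IsScalarTower k A R] [IsLocalRing R]
    [IsNoetherianRing R] (I : Ideal A) [IsPrecomplete I A]
    (hk : Function.Surjective ((residue R).comp (algebraMap k R)))
    (hI : (I.map (algebraMap A R)).radical = maximalIdeal R) : Module.Finite A R := by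
  classical
  have hne : I.map (algebraMap A R) ≠ ⊤ := fun h => by
    rw [h, Ideal.radical_top] at hI
    exact Ideal.IsPrime.ne_top' hI.symm
  have hH : IsHausdorff (I.map (algebraMap A R)) R := IsHausdorff.of_isLocalRing _ _ hne
  have := IsHausdorff.map_algebraMap_iff.1 hH
  obtain ⟨N, hN⟩ := Ideal.exists_radical_pow_le_of_fg (I.map (algebraMap A R))
    (IsNoetherian.noetherian _)
  rw [hI] at hN
  -- Since `k` surjects onto the residue field, generators of the `n`-th power of the maximal ideal
  -- span it over `A` modulo the next power.
  have key : ∀ n, ∃ s : Finset R,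
      Submodule.span A (s : Set R) ⊔ ((maximalIdeal R) ^ n).restrictScalars A = ⊤ := by
    intro n
    induction n with
    | zero => exact ⟨∅, by simp⟩
    | succ n ih =>
      obtain ⟨s, hs⟩ := ih
      obtain ⟨g, hg⟩ := IsNoetherian.noetherian ((maximalIdeal R) ^ n)
      refine ⟨s ∪ g, ?_⟩
      rw [eq_top_iff, ← hs, Finset.coe_union, Submodule.span_union]
      refine sup_le (le_sup_left.trans le_sup_left) ?_
      intro z hz
      rw [Submodule.restrictScalars_mem, ← hg] at hz
      obtain ⟨f, -, rfl⟩ := Submodule.mem_span_finset.1 hz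
      refine Submodule.sum_mem _ fun a ha => ?_
      obtain ⟨l, hl⟩ := hk (residue R (f a))
      have hfa : f a - algebraMap k R l ∈ maximalIdeal R := by
        rw [← residue_eq_zero_iff, map_sub, sub_eq_zero]
        exact hl.symm
      have hag : a ∈ (maximalIdeal R) ^ n := by
        rw [← hg]
        exact Submodule.subset_span ha
      rw [show f a • a = algebraMap k A l • a + (f a - algebraMap k R l) * a by
        rw [smul_eq_mul, algebraMap_smul, Algebra.smul_def l a]
        ring]
      refine Submodule.add_mem _ (Submodule.mem_sup_left (Submodule.mem_sup_right
        (Submodule.smul_mem _ _ (Submodule.subset_span ha)))) (Submodule.mem_sup_right ?_)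
      rw [Submodule.restrictScalars_mem, pow_succ']
      exact Ideal.mul_mem_mul hfa hag
  obtain ⟨s, hs⟩ := key N
  refine Module.Finite.of_isPrecomplete_of_isHausdorff I s (eq_top_iff.2 (hs.symm.le.trans ?_))
  rw [Ideal.smul_top_eq_map]
  exact sup_le_sup_left
    (show Submodule.restrictScalars A _ ≤ Submodule.restrictScalars A _ from hN) _

open IsLocalRing in
/-- In a complete local domain of characteristic `p`, one nonzero element annihilates the colon
relations on all powers of a system of parameters. -/
lemma IsLocalRing.exists_mul_mem_span_pow {R : Type*} [CommRing R] [IsDomain R]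
    [IsLocalRing R] [IsNoetherianRing R] [IsAdicComplete (maximalIdeal R) R]
    (p : ℕ) [Fact p.Prime] [CharP R p] {d : ℕ} {y : Fin d → R}
    (hdim : d ≤ ringKrullDim R)
    (hrad : (Ideal.span (Set.range y)).radical = maximalIdeal R) :
    ∃ c : R, c ≠ 0 ∧ ∀ (t : ℕ) (i : Fin d) (a : R),
      y i ^ t * a ∈ Ideal.span ((fun j => y j ^ t) '' {j | j < i}) →
        c * a ∈ Ideal.span ((fun j => y j ^ t) '' {j | j < i}) := by
  obtain ⟨σ, hσ⟩ := exists_residue_comp_eq_id (R := R) p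
  have hym : ∀ i, y i ∈ maximalIdeal R := fun i => by
    rw [← hrad]
    exact Ideal.le_radical (Ideal.subset_span ⟨i, rfl⟩)
  obtain ⟨Φ, hC, hX⟩ := MvPowerSeries.exists_ringHom_apply_X (maximalIdeal R) σ y hym
  let A := MvPowerSeries (Fin d) (ResidueField R)
  let _ : Algebra (ResidueField R) R := σ.toAlgebra
  let _ : Algebra A R := Φ.toAlgebra
  have : IsDomain A := NoZeroDivisors.to_isDomain _
  have : IsScalarTower (ResidueField R) A R := .of_algebraMap_eq fun r => (hC r).symm
  have hfin : Module.Finite A R :=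
    IsLocalRing.finite_of_radical_map_eq (k := ResidueField R)
      (Ideal.span (Set.range (MvPowerSeries.X : Fin d → A)))
      (by
        change Function.Surjective ((residue R).comp σ)
        rw [hσ]
        exact Function.surjective_id)
      (by
        rw [← hrad, Ideal.map_span, ← Set.range_comp]
        congr 3
        ext i
        exact hX i)
  have hinj : Function.Injective Φ :=
    MvPowerSeries.injective_of_isIntegral hdim Φ (algebraMap_isIntegral_iff.2 inferInstance)
  obtain ⟨c, hc0, hc⟩ := Module.Finite.exists_mul_mem_map_of_mul_mem_map A R
  refine ⟨Φ c, (map_ne_zero_iff Φ hinj).2 hc0, fun t i a ha => ?_⟩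
  have hmap : (Ideal.span ((fun j => (MvPowerSeries.X j : A) ^ t) ''
      ((Finset.univ.filter (· < i) : Finset (Fin d)) : Set (Fin d)))).map (algebraMap A R) =
      Ideal.span ((fun j => y j ^ t) '' {j | j < i}) := by
    rw [Ideal.map_span, ← Set.image_comp]
    congr 1
    simp only [Finset.coe_filter, Finset.mem_univ, true_and]
    refine Set.image_congr fun j _ => ?_
    change Φ (_ ^ t) = _
    rw [map_pow, hX]
  rw [← hmap] at ha ⊢
  refine hc _ (MvPowerSeries.X i ^ t)
    (fun z => MvPowerSeries.mem_span_X_pow_of_X_pow_mul_mem (by simp)) a ?_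
  change Φ _ * a ∈ _
  rwa [map_pow, hX]

/-! ### Frobenius descent of ideal membership -/

namespace PerfectClosure

variable {R : Type*} [CommRing R] {p : ℕ} [Fact p.Prime] [CharP R p]

lemma mk_pow_pow_eq_of (n : ℕ) (r : R) : mk R p (n, r) ^ p ^ n = of R p r := by
  rw [← iterate_frobenius_mk R p n r, iterate_frobenius]

lemma eq_of_pow_pow_eq {n : ℕ} {a b : PerfectClosure R p} (h : a ^ p ^ n = b ^ p ^ n) : a = b := by
  rw [← iterate_frobenius, ← iterate_frobenius] at h
  exact (frobenius_inj (PerfectClosure R p) p).iterate n h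

lemma of_injective [IsReduced R] : Function.Injective (of R p) := fun a b h => by
  simpa [of_apply, eq_iff] using h

/-- Allowing all `m ≥ n` lets several elements share one exponent. -/
lemma exists_pow_pow_eq_of (z : PerfectClosure R p) :
    ∃ n, ∀ m ≥ n, ∃ r, z ^ p ^ m = of R p r := by
  obtain ⟨⟨n, r⟩, rfl⟩ := mk_surjective R p z
  refine ⟨n, fun m hm => ⟨r ^ p ^ (m - n), ?_⟩⟩
  rw [← Nat.add_sub_cancel' hm, pow_add, pow_mul, mk_pow_pow_eq_of, map_pow, Nat.add_sub_cancel_left]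

lemma mk_pow_pow_sub {m n : ℕ} (h : n ≤ m) (r : R) :
    mk R p (m, r) ^ p ^ (m - n) = mk R p (n, r) := by
  refine eq_of_pow_pow_eq (n := n) ?_
  rw [← pow_mul, ← pow_add, Nat.sub_add_cancel h, mk_pow_pow_eq_of, mk_pow_pow_eq_of]

/-- High Frobenius powers of a member of an ideal of the perfect closure descend to `R`. -/
lemma exists_of_mem_span {ι : Type*} {x : ι → PerfectClosure R p} {w : ι → R} {e : ℕ}
    (hx : ∀ j, x j ^ p ^ e = of R p (w j)) (s : Set ι)
    {z : PerfectClosure R p} (hz : z ∈ Ideal.span (x '' s)) :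
    ∃ n ≥ e, ∀ m ≥ n, ∃ r ∈ Ideal.span ((fun j => w j ^ p ^ (m - e)) '' s),
      of R p r = z ^ p ^ m := by
  induction hz using Submodule.span_induction with
  | mem z hz =>
    obtain ⟨j, hj, rfl⟩ := hz
    refine ⟨e, le_rfl, fun m hm => ⟨w j ^ p ^ (m - e), Ideal.subset_span ⟨j, hj, rfl⟩, ?_⟩⟩
    rw [map_pow, ← hx, ← pow_mul, ← pow_add, Nat.add_sub_cancel' hm]
  | zero =>
    exact ⟨e, le_rfl, fun m _ => ⟨0, Ideal.zero_mem _, by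
      rw [map_zero, zero_pow (pow_ne_zero _ (Fact.out : p.Prime).ne_zero)]⟩⟩
  | add a b _ _ iha ihb =>
    obtain ⟨n, hn, h⟩ := iha
    obtain ⟨n', hn', h'⟩ := ihb
    refine ⟨max n n', le_max_of_le_left hn, fun m hm => ?_⟩
    obtain ⟨r, hr, hra⟩ := h m (le_of_max_le_left hm)
    obtain ⟨r', hr', hra'⟩ := h' m (le_of_max_le_right hm)
    exact ⟨r + r', Ideal.add_mem _ hr hr', by rw [map_add, hra, hra', add_pow_char_pow]⟩
  | smul c a _ iha =>
    obtain ⟨n, hn, h⟩ := iha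
    obtain ⟨n', h'⟩ := exists_pow_pow_eq_of c
    refine ⟨max n n', le_max_of_le_left hn, fun m hm => ?_⟩
    obtain ⟨r, hr, hra⟩ := h m (le_of_max_le_left hm)
    obtain ⟨r', hr'⟩ := h' m (le_of_max_le_right hm)
    exact ⟨r' * r, Ideal.mul_mem_left _ _ hr, by rw [map_mul, hra, ← hr', smul_eq_mul, mul_pow]⟩

/-- Taking `p ^ m`-th roots is additive and multiplicative, and sends `w j ^ p ^ (m - e)` to `x j`;
this is the converse of `exists_of_mem_span`. -/
lemma mem_span_of_pow_eq {ι : Type*} {x : ι → PerfectClosure R p} {w : ι → R} {e : ℕ}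
    (hx : ∀ j, x j ^ p ^ e = of R p (w j)) (s : Set ι)
    {m : ℕ} (hm : e ≤ m) {r : R}
    (hr : r ∈ Ideal.span ((fun j => w j ^ p ^ (m - e)) '' s)) {z : PerfectClosure R p}
    (hz : z ^ p ^ m = of R p r) : z ∈ Ideal.span (x '' s) := by
  have key : mk R p (m, r) ∈ Ideal.span (x '' s) := by
    clear hz
    induction hr using Submodule.span_induction with
    | mem r hr =>
      obtain ⟨j, hj, rfl⟩ := hr
      convert! Ideal.subset_span (Set.mem_image_of_mem x hj) using 1
      refine eq_of_pow_pow_eq (n := m) ?_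
      rw [mk_pow_pow_eq_of, map_pow, ← hx, ← pow_mul, ← pow_add, Nat.add_sub_cancel' hm]
    | zero => rw [mk_zero_right]; exact Ideal.zero_mem _
    | add a b _ _ iha ihb =>
      convert! Ideal.add_mem _ iha ihb using 1
      refine eq_of_pow_pow_eq (n := m) ?_
      rw [add_pow_char_pow]
      simp only [mk_pow_pow_eq_of, map_add]
    | smul c a _ iha =>
      convert! Ideal.mul_mem_left _ (mk R p (m, c)) iha using 1
      refine eq_of_pow_pow_eq (n := m) ?_
      rw [mul_pow]
      simp only [mk_pow_pow_eq_of, smul_eq_mul, map_mul]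
  rwa [eq_of_pow_pow_eq (hz.trans (mk_pow_pow_eq_of m r).symm)]

end PerfectClosure

/-! ### Parameters and values in the perfect closure -/

namespace AlmostCM

open IsLocalRing PerfectClosure

variable {R : Type*} [CommRing R] [IsDomain R] {p : ℕ} [Fact p.Prime] [CharP R p]

/-- A system of parameters for the perfect closure has a Frobenius power that is a system of
parameters of `R`. -/
lemma IsSystemOfParametersOver.exists_pow_eq_of [IsLocalRing R] {d : ℕ}
    {x : Fin d → PerfectClosure R p}
    (h : IsSystemOfParametersOver (of R p).range x) :
    d ≤ ringKrullDim R ∧ ∃ (e : ℕ) (w : Fin d → R), (∀ j, x j ^ p ^ e = of R p (w j)) ∧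
      (Ideal.span (Set.range w)).radical = maximalIdeal R := by
  obtain ⟨B, hRB, -, _, y, ⟨hdim, hrad⟩, hxy⟩ := h
  let f : R →+* B := (of R p).codRestrict B fun r => hRB ⟨r, rfl⟩
  have hf : ∀ r, (f r : PerfectClosure R p) = of R p r := fun _ => rfl
  -- Every element of `B` has a `p`-power in `R`; hence `B` is integral over `R`, and units of `B`
  -- lying in `R` are units of `R`.
  have hpow : ∀ b : B, ∃ n r, b ^ p ^ n = f r := fun b => by
    obtain ⟨n, hn⟩ := exists_pow_pow_eq_of (b : PerfectClosure R p)
    obtain ⟨r, hr⟩ := hn n le_rfl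
    exact ⟨n, r, Subtype.ext hr⟩
  have hinj : Function.Injective f := fun a b hab => of_injective (congrArg Subtype.val hab)
  have hint : f.IsIntegral := fun b => by
    obtain ⟨n, r, h⟩ := hpow b
    let _ := f.toAlgebra
    exact IsIntegral.of_pow (R := R) (pow_pos (Fact.out : p.Prime).pos n)
      (h ▸ isIntegral_algebraMap)
  have hloc : ∀ r, IsUnit (f r) ↔ IsUnit r := fun r => by
    refine ⟨fun hu => ?_, fun hu => hu.map f⟩
    obtain ⟨b, hb⟩ := hu.exists_right_inv
    obtain ⟨n, s, h⟩ := hpow b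
    refine (isUnit_pow_iff (pow_ne_zero n (Fact.out : p.Prime).ne_zero)).1
      (IsUnit.of_mul_eq_one s (hinj ?_))
    rw [map_mul, map_pow, ← h, ← mul_pow, hb, one_pow, map_one]
  refine ⟨hdim ▸ hint.ringKrullDim_le, ?_⟩
  have hx : ∀ j, ∃ n, ∀ m ≥ n, ∃ r, x j ^ p ^ m = of R p r := fun j => exists_pow_pow_eq_of _
  choose n hn using hx
  have hw : ∀ j, ∃ r, x j ^ p ^ (Finset.univ.sup n) = of R p r := fun j =>
    hn j _ (Finset.le_sup (Finset.mem_univ j))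
  choose w hw using hw
  refine ⟨_, w, hw, le_antisymm ?_ fun r hr => ?_⟩
  · rw [Ideal.IsPrime.radical_le_iff inferInstance, Ideal.span_le]
    rintro _ ⟨j, rfl⟩
    rw [SetLike.mem_coe, mem_maximalIdeal, mem_nonunits_iff, ← hloc]
    have hyj : y j ∈ maximalIdeal B := hrad ▸ Ideal.le_radical (Ideal.subset_span ⟨j, rfl⟩)
    have : f (w j) = y j ^ p ^ (Finset.univ.sup n) := Subtype.ext (by rw [hf, ← hw, hxy]; rfl)
    rw [this, isUnit_pow_iff (pow_ne_zero _ (Fact.out : p.Prime).ne_zero)]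
    exact hyj
  · have hr' : f r ∈ (Ideal.span (Set.range y)).radical := by
      rw [hrad, mem_maximalIdeal, mem_nonunits_iff, hloc]
      exact hr
    obtain ⟨N, hN⟩ := hr'
    have hN' : of R p (r ^ N) ∈ Ideal.span (x '' Set.univ) := by
      have := Ideal.mem_map_of_mem B.subtype hN
      rw [Ideal.map_span, ← Set.range_comp] at this
      rw [Set.image_univ, show x = B.subtype ∘ y from funext hxy, map_pow]
      exact this
    obtain ⟨m, hm, hm'⟩ := exists_of_mem_span hw Set.univ hN'
    obtain ⟨s, hs, hsr⟩ := hm' (m + 1) (Nat.le_succ m)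
    rw [← map_pow, of_injective.eq_iff, ← pow_mul] at hsr
    refine ⟨N * p ^ (m + 1), hsr ▸ Ideal.span_le (I := Ideal.span (Set.range w)).2 ?_ hs⟩
    rintro _ ⟨j, -, rfl⟩
    exact Ideal.pow_mem_of_mem _ (Ideal.subset_span (Set.mem_range_self j)) _
      (pow_pos (Fact.out : p.Prime).pos _)

/-- Colon relations on a system of parameters for the perfect closure are killed by arbitrarily
high `p`-power roots of a nonzero element. -/
lemma IsSystemOfParametersOver.exists_mk_mul_mem [IsLocalRing R] [IsNoetherianRing R]
    [IsAdicComplete (maximalIdeal R) R] {d : ℕ} {x : Fin d → PerfectClosure R p}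
    (h : IsSystemOfParametersOver (of R p).range x) (i : Fin d) {a : PerfectClosure R p}
    (ha : a ∈ colonIdeal x i) :
    ∃ c : R, c ≠ 0 ∧ ∀ n : ℕ, mk R p (n, c) * a ∈ initialIdeal x i := by
  obtain ⟨hdim, e, w, hw, hrad⟩ := h.exists_pow_eq_of
  obtain ⟨c, hc0, hc⟩ := exists_mul_mem_span_pow p hdim hrad
  refine ⟨c, hc0, ?_⟩
  rw [colonIdeal, Submodule.mem_colon_singleton, initialIdeal] at ha
  obtain ⟨n₁, hn₁, h₁⟩ := exists_of_mem_span hw _ ha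
  obtain ⟨n₂, h₂⟩ := exists_pow_pow_eq_of a
  have hlarge : ∀ m ≥ max n₁ n₂, mk R p (m, c) * a ∈ initialIdeal x i := by
    intro m hm
    have hem : e ≤ m := hn₁.trans (le_of_max_le_left hm)
    obtain ⟨r, hr, hra⟩ := h₁ m (le_of_max_le_left hm)
    obtain ⟨b, hb⟩ := h₂ m (le_of_max_le_right hm)
    have hrb : r = w i ^ p ^ (m - e) * b := of_injective (p := p) <| by
      rw [hra, map_mul, map_pow, ← hb, ← hw, ← pow_mul, ← pow_add, Nat.add_sub_cancel' hem,
        smul_eq_mul, mul_pow, mul_comm]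
    refine mem_span_of_pow_eq hw _ hem (hc _ i b (hrb ▸ hr)) ?_
    rw [mul_pow, mk_pow_pow_eq_of, hb, map_mul]
  intro n
  -- Small `n` follow from large ones, `c ^ (1 / p ^ n)` being a positive power of a higher root of
  -- `c`.
  have := hlarge (n + max n₁ n₂) (Nat.le_add_left _ _)
  rw [← mk_pow_pow_sub (Nat.le_add_right n (max n₁ n₂)) c,
    ← Nat.sub_add_cancel (Nat.one_le_pow _ p (Fact.out : p.Prime).pos), pow_succ, mul_assoc]
  exact Ideal.mul_mem_left _ _ this

/-- The `p`-power roots of a nonzero element have arbitrarily small finite value. -/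
lemma exists_map_mk_lt (v : AddValuation (PerfectClosure R p) (WithTop ℚ))
    (hv : ∀ a : PerfectClosure R p, v a = ⊤ ↔ a = 0) {c : R} (hc : c ≠ 0) {ε : ℝ} (hε : 0 < ε) :
    ∃ (n : ℕ) (q : ℚ), v (mk R p (n, c)) = (q : WithTop ℚ) ∧ (q : ℝ) < ε := by
  have hne : ∀ n, v (mk R p (n, c)) ≠ ⊤ := fun n h => hc <| of_injective (p := p) <| by
    rw [← mk_pow_pow_eq_of n, (hv _).1 h, map_zero,
      zero_pow (pow_ne_zero _ (Fact.out : p.Prime).ne_zero)]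
  choose q hq using fun n => WithTop.ne_top_iff_exists.1 (hne n)
  have hqn : ∀ n, (p : ℝ) ^ n * q n = q 0 := fun n => by
    have h := v.map_pow (mk R p (n, c)) (p ^ n)
    rw [mk_pow_pow_eq_of, of_apply, ← hq, ← hq, ← WithTop.coe_nsmul, WithTop.coe_inj,
      nsmul_eq_mul] at h
    rw [h]
    push_cast
    ring
  obtain ⟨n, hn⟩ := pow_unbounded_of_one_lt ((q 0 : ℝ) / ε)
    (show (1 : ℝ) < p by exact_mod_cast (Fact.out : p.Prime).one_lt)
  refine ⟨n, q n, (hq n).symm, ?_⟩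
  rw [div_lt_iff₀ hε, ← hqn n] at hn
  exact lt_of_mul_lt_mul_left hn (by positivity)

end AlmostCM

/-- `PerfectClosure R p` is the perfect closure of `R`, with `PerfectClosure.of R p` the inclusion
of `R`, and `PerfectClosure.mk R p (n, c)` is the element `c ^ (1 / p ^ n)`. -/
theorem proposition1p4 {R : Type*} [CommRing R] [IsDomain R] [IsLocalRing R] [IsNoetherianRing R]
    [IsAdicComplete (IsLocalRing.maximalIdeal R) R]
    (p : ℕ) [Fact p.Prime] [CharP R p]
    (v : AddValuation (PerfectClosure R p) (WithTop ℚ))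
    (hv_top : ∀ a : PerfectClosure R p, v a = ⊤ ↔ a = 0)
    (hv_nonneg : ∀ a : PerfectClosure R p, 0 ≤ v a)
    (hv_pos : ∀ r ∈ IsLocalRing.maximalIdeal R, 0 < v (PerfectClosure.of R p r)) :
    AlmostCM.IsAlmostCohenMacaulay (PerfectClosure.of R p).range v ∧
    ∀ (d : ℕ) (x : Fin d → PerfectClosure R p),
      AlmostCM.IsSystemOfParametersOver (PerfectClosure.of R p).range x →
      ∀ i : Fin d, ∀ a ∈ AlmostCM.colonIdeal x i,
        ∃ c : R, c ≠ 0 ∧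
          ∀ n : ℕ, PerfectClosure.mk R p (n, c) * a ∈ AlmostCM.initialIdeal x i := by
  refine ⟨fun d x hx i m ε hε => ?_, fun d x hx i a ha => hx.exists_mk_mul_mem i ha⟩
  obtain ⟨⟨a, ha⟩, rfl⟩ := Submodule.mkQ_surjective _ m
  obtain ⟨c, hc0, hc⟩ := hx.exists_mk_mul_mem i ha
  obtain ⟨n, hn⟩ := AlmostCM.exists_map_mk_lt v hv_top hc0 hε
  refine ⟨PerfectClosure.mk R p (n, c), hn, ?_⟩
  rw [← map_smul, Submodule.mkQ_apply, Submodule.Quotient.mk_eq_zero]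
  exact hc n
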